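/- For $A\in\mathbb{R}^{m\times n}$ with rows $a_1,\dots,a_m$ and $1\le p<\infty$, let $l_i^{(p)}=\sup_{x\ne 0}|a_ix|^p/\|Ax\|_p^p$ (with quotients $0/0$ counted as $0$) be the $\ell_p$ leverage scores of $A$. For a real number $k\ge 0$, pure $\ell_p$ leverage score sampling includes each row $i$ in a random set $S$, independently over the rows, with probability $p_i=\min\{1,k\,l_i^{(p)}\}$. The expected number of sampled rows is then $\sum_i p_i$. We say that $S$ yields an $\ell_p$ subspace embedding of $A$ if there are an $\varepsilon\in(0,1)$ and weights $w_i>0$ $(i\in S)$ such that $$\Big|\sum_{i\in S}w_i|a_ix|^p-\sum_{i=1}^m|a_ix|^p\Big|\le\varepsilon\sum_{i=1}^m|a_ix|^p\qquad\text{for all }x\in\mathbb{R}^n .$$ Theorem. There is an absolute constant $c>0$ such that for every real $p\ge 1$ and every integer $d\ge 2$ there is an $m_0$ such that for every $m\ge m_0$ there is a matrix $A\in\mathbb{R}^{m\times 2d}$ with the following property. For every real $k\ge 0$, with probability at least $1-e^{-cd}$ the random set $S$ does not yield an $\ell_p$ subspace embedding of $A$, for any $\varepsilon\in(0,1)$ and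 any positive weights, unless the expected number of sampled rows satisfies $$\sum_{i=1}^m p_i\;\ge\; c\,\frac{d^{2-p/2}}{(\log d)^{p/2}} ,$$ and unless the oversampling factor satisfies $k\ge c\,d^{1-p/2}/(\log d)^{p/2}$. (If either of the two inequalities fails, then $S$ fails to yield an embedding with probability at least $1-e^{-cd}$.) Thus pure $\ell_p$ leverage score sampling needs $\Omega\big(d^{2-p/2}/(\log d)^{p/2}\big)$ samples in the worst case. -/

import Mathlib

open MeasureTheory ProbabilityTheory
open scoped NNReal Matrix

noncomputable section

namespace LpSampling

/-- `‖v‖_p ^ p = ∑ i, |v i| ^ p`. -/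
def lpPow {m : ℕ} (p : ℝ) (v : Fin m → ℝ) : ℝ := ∑ i, |v i| ^ p

/-- The `ℓ_p` leverage score (`ℓ_p` sensitivity) of the `i`-th row of `A`, that is, the supremum over
`x ≠ 0` of `|a_i x| ^ p / ‖A x‖_p ^ p`. For `p > 0` a quotient with `A x = 0` counts as `0`, and all
quotients lie in `[0, 1]`. -/
def leverageScore {m n : ℕ} (p : ℝ) (A : Matrix (Fin m) (Fin n) ℝ) (i : Fin m) : ℝ :=
  ⨆ x : {x : Fin n → ℝ // x ≠ 0}, |(A *ᵥ x.1) i| ^ p / lpPow p (A *ᵥ x.1)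

theorem lpPow_nonneg {m : ℕ} (p : ℝ) (v : Fin m → ℝ) : 0 ≤ lpPow p v :=
  Finset.sum_nonneg fun _ _ => Real.rpow_nonneg (abs_nonneg _) _

theorem leverageScore_nonneg {m n : ℕ} (p : ℝ) (A : Matrix (Fin m) (Fin n) ℝ) (i : Fin m) :
    0 ≤ leverageScore p A i :=
  Real.iSup_nonneg fun _ => div_nonneg (Real.rpow_nonneg (abs_nonneg _) _) (lpPow_nonneg _ _)

/-- All the quotients in the definition of the leverage score are at most `1`, so that the supremum
is a genuine one. -/
theorem leverageScore_bddAbove {m n : ℕ} (p : ℝ) (A : Matrix (Fin m) (Fin n) ℝ) (i : Fin m) :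
    BddAbove (Set.range fun x : {x : Fin n → ℝ // x ≠ 0} =>
      |(A *ᵥ x.1) i| ^ p / lpPow p (A *ᵥ x.1)) := by
  refine ⟨1, ?_⟩
  rintro _ ⟨x, rfl⟩
  refine div_le_one_of_le₀ ?_ (lpPow_nonneg _ _)
  exact Finset.single_le_sum (f := fun j => |(A *ᵥ x.1) j| ^ p)
    (fun _ _ => Real.rpow_nonneg (abs_nonneg _) _) (Finset.mem_univ i)

/-- The sampling probability `p_i = min {1, k * l_i}` of pure `ℓ_p` leverage score sampling. -/
def sampleProb {m n : ℕ} (p : ℝ) (A : Matrix (Fin m) (Fin n) ℝ) (k : ℝ≥0) (i : Fin m) :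
    unitInterval :=
  ⟨min 1 (k * leverageScore p A i),
    le_min zero_le_one (mul_nonneg k.2 (leverageScore_nonneg p A i)), min_le_left _ _⟩

/-- The law of the random sample: row `i` is sampled (`ω i = true`) with probability `q i`,
independently over the rows. -/
def rowSampling {m : ℕ} (q : Fin m → unitInterval) : Measure (Fin m → Bool) :=
  Measure.pi fun i => bernoulliMeasure true false (q i)

/-- The set of sampled rows of the outcome `ω`. -/
def sampledRows {m : ℕ} (ω : Fin m → Bool) : Finset (Fin m) :=
  Finset.univ.filter fun i => ω i = true

/-- The rows in `S` with weights `w` form an `ℓ_p` subspace embedding of `A` with distortion `ε`: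
for all `x`, `∑_{i ∈ S} w_i |a_i x| ^ p = (1 ± ε) ∑_i |a_i x| ^ p`. -/
def IsLpEmbedding {m n : ℕ} (p ε : ℝ) (A : Matrix (Fin m) (Fin n) ℝ) (S : Finset (Fin m))
    (w : Fin m → ℝ) : Prop :=
  ∀ x : Fin n → ℝ,
    |(∑ i ∈ S, w i * |(A *ᵥ x) i| ^ p) - lpPow p (A *ᵥ x)| ≤ ε * lpPow p (A *ᵥ x)

/-- The sampled rows are an `ℓ_p` subspace embedding of `A` for some distortion in `(0, 1)` and
some positive weights. -/
def SampleEmbeds {m n : ℕ} (p : ℝ) (A : Matrix (Fin m) (Fin n) ℝ) (ω : Fin m → Bool) : Prop :=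
  ∃ ε : ℝ, 0 < ε ∧ ε < 1 ∧ ∃ w : Fin m → ℝ, (∀ i ∈ sampledRows ω, 0 < w i) ∧
    IsLpEmbedding p ε A (sampledRows ω) w

end LpSampling

end

/-!
The hard instance is a block diagonal matrix `diag(B, E)` with `d` columns in each block.

The block `B` has full column rank, and its leverage scores sum to `O((d log d) ^ (p / 2))`
(`exists_matrix_small_leverage`). For `p ≤ 2` its rows are all the `2 ^ d` sign vectors: the
Cauchy-Schwarz inequality bounds each `|b_i x|` by `√d ‖x‖₂`, while the Khintchine inequality
(`rpow_le_sum_abs_signSum_rpow`, from the second and fourth moments) bounds `‖B x‖_p ^ p` from below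
by `2 ^ d ‖x‖₂ ^ p / 4`. For `p ≥ 2` the identity matrix is good enough, because `d` is then at most
a constant multiple of `(d log d) ^ (p / 2)`. The leverage scores of `diag(B, E)` at the rows of `B`
are no larger.

If fewer than `d` rows of `B` are sampled, these have a common zero `x ≠ 0`; the vector `(x, 0)`
vanishes on all sampled rows, though not on all rows, so that no weights give an embedding
(`not_sampleEmbeds_hardMatrix`). If `k ≤ c d ^ (1 - p / 2) / (log d) ^ (p / 2)`, then only `8 c d`
rows of `B` are sampled in expectation, and a Chernoff bound (`rowSampling_real_le_card_le`) shows
that fewer than `d` are sampled except with probability `e ^ (-c d)`.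

The block `E` makes this costly in samples: its rows repeat each of `d` basis vectors at least `N`
times, for a large `N`. The copies of a basis vector share a total leverage of `1`, so that at least
`min(N, k)` of them are sampled in expectation (`mul_min_le_sum_sampleProb`). A bound on the expected
number of samples thus gives, after division by `d`, a bound on `k`.
-/

namespace LpSampling

/-! ### Rank deficiency rules out an embedding -/

theorem not_sampleEmbeds_of_mulVec_eq_zero {m n : ℕ} {p : ℝ} (hp : p ≠ 0)
    {A : Matrix (Fin m) (Fin n) ℝ} {ω : Fin m → Bool} {x : Fin n → ℝ}
    (hx : ∀ i, ω i = true → (A *ᵥ x) i = 0) (hpos : 0 < lpPow p (A *ᵥ x)) :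
    ¬ SampleEmbeds p A ω := by
  rintro ⟨ε, -, hε, w, -, h⟩
  have h0 : ∑ i ∈ sampledRows ω, w i * |(A *ᵥ x) i| ^ p = 0 :=
    Finset.sum_eq_zero fun i hi => by
      rw [hx i (Finset.mem_filter.1 hi).2, abs_zero, Real.zero_rpow hp, mul_zero]
  have := h x
  rw [h0, zero_sub, abs_neg, abs_of_pos hpos] at this
  nlinarith

/-- Fewer than `d` linear forms on `ℝ ^ d` have a common nontrivial zero. -/
theorem exists_ne_zero_mulVec_eq_zero {n d : ℕ} (B : Matrix (Fin n) (Fin d) ℝ)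
    (T : Finset (Fin n)) (hT : T.card < d) :
    ∃ x : Fin d → ℝ, x ≠ 0 ∧ ∀ i ∈ T, (B *ᵥ x) i = 0 := by
  let f : (Fin d → ℝ) →ₗ[ℝ] (T → ℝ) := (B.submatrix (Subtype.val : T → Fin n) id).mulVecLin
  have hf : LinearMap.ker f ≠ ⊥ := f.ker_ne_bot_of_finrank_lt (by simpa using hT)
  obtain ⟨x, hx, hx0⟩ := (Submodule.ne_bot_iff _).1 hf
  exact ⟨x, hx0, fun i hi => congrFun (LinearMap.mem_ker.1 hx) ⟨i, hi⟩⟩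

/-! ### A Chernoff bound for the number of sampled rows -/

/-- The exponential moment of a Bernoulli variable, from `1 + q (e - 1) ≤ e ^ (2 q)`. The rows
outside the set of interest (where `P` fails) contribute the factor `1`. -/
theorem integral_bernoulliMeasure_ite_exp_le (q : unitInterval) (P : Prop) [Decidable P] :
    ∫ b, (if P ∧ b = true then Real.exp 1 else 1) ∂(bernoulliMeasure true false q) ≤
      Real.exp (if P then 2 * (q : ℝ) else 0) := by
  by_cases h : P
  · have h3 : Real.exp 1 ≤ 3 := Real.exp_one_lt_three.le
    have hq : (0 : ℝ) ≤ q := q.2.1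
    rw [integral_bernoulliMeasure]
    simp only [h, true_and, if_true, Bool.false_eq_true, if_false, smul_eq_mul]
    have := Real.add_one_le_exp (2 * (q : ℝ))
    simp
    nlinarith
  · simp [h]

theorem rowSampling_real_le_card_le {m : ℕ} (q : Fin m → unitInterval) (R : Finset (Fin m))
    (d : ℕ) :
    (rowSampling q).real {ω | d ≤ (R.filter fun i => ω i = true).card} ≤
      Real.exp (2 * ∑ i ∈ R, (q i : ℝ) - d) := by
  set f : Fin m → Bool → ℝ := fun i b => if i ∈ R ∧ b = true then Real.exp 1 else 1 with hf
  have hprod (ω : Fin m → Bool) :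
      ∏ i, f i (ω i) = Real.exp (R.filter fun i => ω i = true).card := by
    rw [← mul_one ((R.filter fun i => ω i = true).card : ℝ), Real.exp_nat_mul,
      ← Finset.prod_const, Finset.prod_filter, ← Finset.prod_subset (Finset.subset_univ R)]
    · exact Finset.prod_congr rfl fun i hi => by simp [hf, hi]
    · intro i _ hi
      simp [hf, hi]
  have hset : {ω : Fin m → Bool | d ≤ (R.filter fun i => ω i = true).card} =
      {ω | Real.exp d ≤ ∏ i, f i (ω i)} := by
    ext ω
    simp [hprod]
  have hmarkov : Real.exp d * (rowSampling q).real {ω | Real.exp d ≤ ∏ i, f i (ω i)} ≤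
      ∫ ω, ∏ i, f i (ω i) ∂(rowSampling q) := by
    have : IsProbabilityMeasure (rowSampling q) := by unfold rowSampling; infer_instance
    refine mul_meas_ge_le_integral_of_nonneg (Filter.Eventually.of_forall fun ω => ?_)
      Integrable.of_finite _
    simp only [hprod, Pi.zero_apply]
    positivity
  have hint : ∫ ω, ∏ i, f i (ω i) ∂(rowSampling q) ≤ Real.exp (2 * ∑ i ∈ R, (q i : ℝ)) := by
    calc ∫ ω, ∏ i, f i (ω i) ∂(rowSampling q)
        = ∏ i, ∫ b, f i b ∂(bernoulliMeasure true false (q i)) := integral_fintype_prod_eq_prod f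
      _ ≤ ∏ i, Real.exp (if i ∈ R then 2 * (q i : ℝ) else 0) :=
        Finset.prod_le_prod
          (fun i _ => integral_nonneg fun b => by
            simp only [hf, Pi.zero_apply]
            split_ifs <;> positivity)
          fun i _ => integral_bernoulliMeasure_ite_exp_le (q i) (i ∈ R)
      _ = Real.exp (2 * ∑ i ∈ R, (q i : ℝ)) := by
        rw [← Real.exp_sum, Finset.sum_ite_mem, Finset.univ_inter, Finset.mul_sum]
  rw [hset, Real.exp_sub, le_div_iff₀' (Real.exp_pos _)]
  exact hmarkov.trans hint

/-! ### Moments of Rademacher sums -/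

/-- The Rademacher sum `∑ j, ± x j` whose signs are given by `σ`. -/
def signSum {d : ℕ} (σ : Fin d → Bool) (x : Fin d → ℝ) : ℝ := ∑ j, (if σ j then 1 else -1) * x j

theorem sum_signSum_succ {d : ℕ} (x : Fin (d + 1) → ℝ) (F : ℝ → ℝ) :
    ∑ σ, F (signSum σ x) = ∑ σ : Fin d → Bool,
      (F (x 0 + signSum σ (Fin.tail x)) + F (-x 0 + signSum σ (Fin.tail x))) := by
  rw [← (Fin.consEquiv fun _ => Bool).sum_comp, Fintype.sum_prod_type, Fintype.sum_bool,
    ← Finset.sum_add_distrib]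
  simp [signSum, Fin.sum_univ_succ, Fin.tail]

theorem sum_signSum_sq {d : ℕ} (x : Fin d → ℝ) :
    ∑ σ, signSum σ x ^ 2 = 2 ^ d * ∑ j, x j ^ 2 := by
  induction d with
  | zero => simp [signSum]
  | succ d ih =>
    rw [sum_signSum_succ x (· ^ 2), Fin.sum_univ_succ]
    have (s : ℝ) : (x 0 + s) ^ 2 + (-x 0 + s) ^ 2 = 2 * x 0 ^ 2 + 2 * s ^ 2 := by ring
    simp only [this, Finset.sum_add_distrib, ← Finset.mul_sum, ih]
    simp [Fin.tail]
    ring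

theorem sum_signSum_pow_four_le {d : ℕ} (x : Fin d → ℝ) :
    ∑ σ, signSum σ x ^ 4 ≤ 2 ^ d * (3 * (∑ j, x j ^ 2) ^ 2) := by
  induction d with
  | zero => simp [signSum]
  | succ d ih =>
    rw [sum_signSum_succ x (· ^ 4), Fin.sum_univ_succ]
    have (s : ℝ) : (x 0 + s) ^ 4 + (-x 0 + s) ^ 4 =
        2 * x 0 ^ 4 + 12 * x 0 ^ 2 * s ^ 2 + 2 * s ^ 4 := by ring
    simp only [this, Finset.sum_add_distrib, ← Finset.mul_sum, sum_signSum_sq]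
    have h := ih (Fin.tail x)
    simp only [Fin.tail] at h ⊢
    simp only [Finset.sum_const, Finset.card_univ, Fintype.card_fun, Fintype.card_bool,
      Fintype.card_fin, nsmul_eq_mul, Nat.cast_pow, Nat.cast_ofNat]
    have : 0 ≤ (2 : ℝ) ^ d * x 0 ^ 4 := by positivity
    rw [pow_succ (2 : ℝ) d]
    linarith

theorem abs_signSum_le {d : ℕ} (σ : Fin d → Bool) (x : Fin d → ℝ) :
    |signSum σ x| ≤ √d * √(∑ j, x j ^ 2) := by
  rw [← Real.sqrt_mul (Nat.cast_nonneg d)]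
  refine Real.abs_le_sqrt ?_
  have := Finset.sum_mul_sq_le_sq_mul_sq Finset.univ (fun j => if σ j then (1 : ℝ) else -1) x
  simpa [signSum, ite_pow] using this

/-- A polynomial minorant of `t ^ p` that makes the second and fourth moments control the `p`-th. -/
theorem sq_sub_pow_four_div_four_le_rpow {p t : ℝ} (hp0 : 0 ≤ p) (hp : p ≤ 2) (ht : 0 ≤ t) :
    t ^ 2 - t ^ 4 / 4 ≤ t ^ p := by
  rcases le_total t 1 with h | h
  · rcases ht.eq_or_lt with rfl | ht'
    · simpa using Real.rpow_nonneg le_rfl p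
    · have : t ^ (2 : ℝ) ≤ t ^ p := Real.rpow_le_rpow_of_exponent_ge ht' h hp
      rw [Real.rpow_two] at this
      have : 0 ≤ t ^ 4 := by positivity
      linarith
  · have : 1 ≤ t ^ p := Real.one_le_rpow h hp0
    nlinarith [sq_nonneg (t ^ 2 - 2)]

/-- A weak form of the **Khintchine inequality**. -/
theorem rpow_le_sum_abs_signSum_rpow {d : ℕ} {p : ℝ} (hp0 : 0 ≤ p) (hp : p ≤ 2)
    {x : Fin d → ℝ} (hx : 0 < ∑ j, x j ^ 2) :
    2 ^ d * √(∑ j, x j ^ 2) ^ p ≤ 4 * ∑ σ, |signSum σ x| ^ p := by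
  set s := √(∑ j, x j ^ 2) with hs
  have hs0 : 0 < s := Real.sqrt_pos.2 hx
  have hs2 : ∑ j, x j ^ 2 = s ^ 2 := (Real.sq_sqrt hx.le).symm
  have key (σ : Fin d → Bool) :
      s ^ p * (signSum σ x ^ 2 / s ^ 2 - signSum σ x ^ 4 / (4 * s ^ 4)) ≤ |signSum σ x| ^ p := by
    have h := sq_sub_pow_four_div_four_le_rpow hp0 hp (div_nonneg (abs_nonneg (signSum σ x)) hs0.le)
    rw [Real.div_rpow (abs_nonneg _) hs0.le, le_div_iff₀' (by positivity)] at h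
    refine le_of_eq_of_le ?_ h
    rw [div_pow, div_pow, sq_abs, Even.pow_abs (by decide)]
    ring
  have hsum := Finset.sum_le_sum fun σ (_ : σ ∈ Finset.univ) => key σ
  rw [← Finset.mul_sum, Finset.sum_sub_distrib, ← Finset.sum_div, ← Finset.sum_div, sum_signSum_sq,
    hs2] at hsum
  have h4 := sum_signSum_pow_four_le x
  rw [hs2] at h4
  have h4' : (∑ σ, signSum σ x ^ 4) / (4 * s ^ 4) ≤ 2 ^ d * (3 / 4) := by
    rw [div_le_iff₀ (by positivity)]
    linarith
  rw [mul_div_cancel_right₀ _ (by positivity)] at hsum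
  have : 0 < s ^ p := by positivity
  nlinarith

/-! ### Matrices with small total leverage -/

/-- There is a matrix `B` with `d` columns, of full column rank, all of whose `ℓ_p` leverage scores
are at most some `L` such that `n * L`, and hence their sum, is `O((d log d) ^ (p / 2))` with a
constant independent of `p`. For `p ≤ 2` the rows are all the sign vectors; for `p ≥ 2` the identity
matrix will do. -/
theorem exists_matrix_small_leverage {p : ℝ} (hp : 1 ≤ p) {d : ℕ} (hd : 2 ≤ d) :
    ∃ (n : ℕ) (B : Matrix (Fin n) (Fin d) ℝ) (L : ℝ), 0 ≤ L ∧
      (∀ x ≠ 0, 0 < lpPow p (B *ᵥ x)) ∧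
      (∀ x i, |(B *ᵥ x) i| ^ p ≤ L * lpPow p (B *ᵥ x)) ∧
      n * L ≤ 8 * (d * Real.log d) ^ (p / 2) := by
  have hd' : (2 : ℝ) ≤ d := by exact_mod_cast hd
  have hd0 : (0 : ℝ) ≤ d := Nat.cast_nonneg d
  have hlog : 1 / 2 ≤ Real.log d := by
    have := Real.log_two_gt_d9
    have := Real.log_le_log two_pos hd'
    linarith
  rcases le_total p 2 with hp2 | hp2
  · let e := (Fintype.equivFin (Fin d → Bool)).symm
    let B : Matrix (Fin (Fintype.card (Fin d → Bool))) (Fin d) ℝ :=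
      fun i j => if e i j then 1 else -1
    have hB (x : Fin d → ℝ) (i) : (B *ᵥ x) i = signSum (e i) x := rfl
    have hsum (x : Fin d → ℝ) : lpPow p (B *ᵥ x) = ∑ σ, |signSum σ x| ^ p := by
      simp only [lpPow, hB]
      exact e.sum_comp fun σ => |signSum σ x| ^ p
    have hpos {x : Fin d → ℝ} (hx : x ≠ 0) : 0 < ∑ j, x j ^ 2 := by
      obtain ⟨j, hj⟩ := Function.ne_iff.1 hx
      exact Finset.sum_pos' (fun _ _ => sq_nonneg _) ⟨j, Finset.mem_univ _, by
        have : x j ≠ 0 := hj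
        positivity⟩
    refine ⟨_, B, 4 * (d : ℝ) ^ (p / 2) / 2 ^ d, by positivity, fun x hx => ?_, fun x i => ?_, ?_⟩
    · have h := rpow_le_sum_abs_signSum_rpow (by linarith) hp2 (hpos hx)
      have : 0 < √(∑ j, x j ^ 2) := Real.sqrt_pos.2 (hpos hx)
      have : 0 < 2 ^ d * √(∑ j, x j ^ 2) ^ p := by positivity
      rw [hsum]
      linarith
    · rcases eq_or_ne x 0 with rfl | hx
      · simp [lpPow, Real.zero_rpow (by linarith : p ≠ 0)]
      have h := rpow_le_sum_abs_signSum_rpow (by linarith) hp2 (hpos hx)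
      have h1 := Real.rpow_le_rpow (abs_nonneg _) (abs_signSum_le (e i) x) (by linarith : 0 ≤ p)
      rw [Real.mul_rpow (Real.sqrt_nonneg _) (Real.sqrt_nonneg _), Real.sqrt_eq_rpow (d : ℝ),
        ← Real.rpow_mul (Nat.cast_nonneg d), one_div_mul_eq_div] at h1
      rw [hB, hsum]
      refine h1.trans ?_
      rw [div_mul_eq_mul_div, le_div_iff₀ (by positivity)]
      linarith [mul_le_mul_of_nonneg_left h (Real.rpow_nonneg hd0 (p / 2))]
    · rw [Real.mul_rpow (by positivity) (by positivity)]
      have h2 : (1 / 2 : ℝ) ≤ Real.log d ^ (p / 2) := calc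
        (1 / 2 : ℝ) = (1 / 2) ^ (1 : ℝ) := (Real.rpow_one _).symm
        _ ≤ (1 / 2) ^ (p / 2) :=
          Real.rpow_le_rpow_of_exponent_ge (by norm_num) (by norm_num) (by linarith)
        _ ≤ _ := Real.rpow_le_rpow (by norm_num) hlog (by linarith)
      have h3 : 0 ≤ (d : ℝ) ^ (p / 2) := by positivity
      simp only [Fintype.card_fun, Fintype.card_bool, Fintype.card_fin, Nat.cast_pow,
        Nat.cast_ofNat]
      rw [mul_div_cancel₀ _ (by positivity)]
      nlinarith
  · refine ⟨d, 1, 1, zero_le_one, fun x hx => ?_, fun x i => ?_, ?_⟩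
    · obtain ⟨j, hj⟩ := Function.ne_iff.1 hx
      have hj' : 0 < |x j| := abs_pos.2 hj
      rw [Matrix.one_mulVec]
      exact Finset.sum_pos' (fun _ _ => by positivity) ⟨j, Finset.mem_univ _, by positivity⟩
    · rw [one_mul]
      exact Finset.single_le_sum (f := fun j => |((1 : Matrix (Fin d) (Fin d) ℝ) *ᵥ x) j| ^ p)
        (fun _ _ => Real.rpow_nonneg (abs_nonneg _) _) (Finset.mem_univ i)
    · have h1 : 1 ≤ d * Real.log d := by nlinarith
      have h2 : d * Real.log d ≤ (d * Real.log d) ^ (p / 2) :=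
        Real.self_le_rpow_of_one_le h1 (by linarith)
      nlinarith

/-! ### The hard instance -/

/-- The block matrix `diag(B, E)` with `m` rows, where the rows of `E` cycle through the `d` standard
basis vectors. Rows and columns are numbered from `0`. -/
def hardMatrix {n d : ℕ} (B : Matrix (Fin n) (Fin d) ℝ) (m : ℕ) :
    Matrix (Fin m) (Fin (2 * d)) ℝ := fun i j =>
  if hi : i.1 < n then if hj : j.1 < d then B ⟨i, hi⟩ ⟨j, hj⟩ else 0
  else if j.1 = d + (i - n) % d then 1 else 0

section hardMatrix

variable {n d m : ℕ} (B : Matrix (Fin n) (Fin d) ℝ)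

/-- The part of a vector that meets the block `B` of `hardMatrix B m`. -/
def firstHalf (x : Fin (2 * d) → ℝ) : Fin d → ℝ := fun j => x ⟨j, by omega⟩

theorem hardMatrix_mulVec_of_lt (x : Fin (2 * d) → ℝ) {i : Fin m} (hi : i.1 < n) :
    (hardMatrix B m *ᵥ x) i = (B *ᵥ firstHalf x) ⟨i, hi⟩ := by
  simp only [Matrix.mulVec, dotProduct]
  symm
  refine Fintype.sum_of_injective (fun j : Fin d => (⟨j, by omega⟩ : Fin (2 * d))) ?_ _ _ ?_ ?_
  · intro a b h
    simpa [Fin.ext_iff] using h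
  · intro j hj
    have : ¬ j.1 < d := fun h => hj ⟨⟨j, h⟩, rfl⟩
    simp [hardMatrix, hi, this]
  · intro j
    simp [hardMatrix, hi, firstHalf]

theorem hardMatrix_mulVec_of_le (x : Fin (2 * d) → ℝ) {i : Fin m} (hi : n ≤ i.1)
    {j : Fin (2 * d)} (hj : j.1 = d + (i - n) % d) :
    (hardMatrix B m *ᵥ x) i = x j := by
  simp only [Matrix.mulVec, dotProduct]
  rw [Finset.sum_eq_single j]
  · simp [hardMatrix, hi.not_gt, hj]
  · intro j' _ hne
    have : j'.1 ≠ d + (i - n) % d := fun h => hne (Fin.ext (h.trans hj.symm))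
    simp [hardMatrix, hi.not_gt, this]
  · simp

theorem lpPow_le_lpPow_hardMatrix (hm : n ≤ m) (p : ℝ) (x : Fin (2 * d) → ℝ) :
    lpPow p (B *ᵥ firstHalf x) ≤ lpPow p (hardMatrix B m *ᵥ x) := by
  have h : lpPow p (B *ᵥ firstHalf x) =
      ∑ i ∈ Finset.univ.map (Fin.castLEEmb hm), |(hardMatrix B m *ᵥ x) i| ^ p := by
    rw [Finset.sum_map]
    refine Finset.sum_congr rfl fun i _ => ?_
    rw [hardMatrix_mulVec_of_lt B x (i := Fin.castLEEmb hm i) i.2]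
    rfl
  rw [h]
  exact Finset.sum_le_univ_sum_of_nonneg fun _ => Real.rpow_nonneg (abs_nonneg _) _

theorem leverageScore_hardMatrix_le (hm : n ≤ m) {p L : ℝ} (hL : 0 ≤ L)
    (hB : ∀ x i, |(B *ᵥ x) i| ^ p ≤ L * lpPow p (B *ᵥ x)) {i : Fin m} (hi : i.1 < n) :
    leverageScore p (hardMatrix B m) i ≤ L := by
  refine Real.iSup_le (fun x => div_le_of_le_mul₀ (lpPow_nonneg _ _) hL ?_) hL
  rw [hardMatrix_mulVec_of_lt B _ hi]
  exact (hB _ _).trans (mul_le_mul_of_nonneg_left (lpPow_le_lpPow_hardMatrix B hm p _) hL)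

/-- The indices of the rows of `hardMatrix B m` below `B` that equal the `r`-th basis vector of the
second half. -/
def copies (n d m : ℕ) (r : Fin d) : Finset (Fin m) :=
  Finset.univ.filter fun i => n ≤ i.1 ∧ (i - n) % d = r

theorem le_card_copies {N : ℕ} (hm : n + d * N ≤ m) (r : Fin d) : N ≤ (copies n d m r).card := by
  have hlt (t : Fin N) : n + (r + d * t) < m := by
    have h1 : d * (t + 1) ≤ d * N := Nat.mul_le_mul_left d t.2
    have := r.2
    rw [mul_add] at h1
    omega
  rw [← Fintype.card_fin N, ← Finset.card_univ]
  refine Finset.card_le_card_of_injOn (fun t => ⟨n + (r + d * t), hlt t⟩) ?_ ?_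
  · intro t _
    simp [copies, Nat.mod_eq_of_lt r.2]
  · intro t _ t' _ h
    have hd : d ≠ 0 := by have := r.2; omega
    simpa [Fin.ext_iff, hd] using h

/-- Each of the copies of a basis vector has a leverage score at least (in fact, equal to) the
inverse of their number, as the basis vector itself shows. -/
theorem le_leverageScore_hardMatrix {p : ℝ} (hp : p ≠ 0) {r : Fin d} {i : Fin m}
    (hi : i ∈ copies n d m r) :
    ((copies n d m r).card : ℝ)⁻¹ ≤ leverageScore p (hardMatrix B m) i := by
  let j : Fin (2 * d) := ⟨d + r, by omega⟩
  let x : Fin (2 * d) → ℝ := Pi.single j 1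
  have hx : x ≠ 0 := by simp [x]
  have hfirst : firstHalf x = 0 := by
    ext a
    have : (⟨a, by omega⟩ : Fin (2 * d)) ≠ j := by
      have := a.2
      simp only [j, ne_eq, Fin.mk.injEq]
      omega
    simp [firstHalf, x, this]
  have hval (i' : Fin m) : (hardMatrix B m *ᵥ x) i' = if i' ∈ copies n d m r then 1 else 0 := by
    by_cases h : i'.1 < n
    · rw [hardMatrix_mulVec_of_lt B x h, hfirst]
      simp [copies, h]
    · have hlt : (i'.1 - n) % d < d := Nat.mod_lt _ r.pos
      rw [hardMatrix_mulVec_of_le B x (not_lt.1 h) (j := ⟨d + (i' - n) % d, by omega⟩) rfl]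
      simp [copies, not_lt.1 h, x, j, Pi.single_apply]
  refine le_of_eq_of_le ?_ (le_ciSup (leverageScore_bddAbove p (hardMatrix B m) i) ⟨x, hx⟩)
  have (i' : Fin m) : |(hardMatrix B m *ᵥ x) i'| ^ p = if i' ∈ copies n d m r then 1 else 0 := by
    rw [hval]
    split_ifs <;> simp [Real.zero_rpow hp]
  simp only [lpPow, this]
  simp [hi]

theorem mul_min_le_sum_sampleProb {p : ℝ} (hp : p ≠ 0) {N : ℕ} (hm : n + d * N ≤ m) (k : ℝ≥0) :
    d * min (N : ℝ) k ≤ ∑ i, (sampleProb p (hardMatrix B m) k i : ℝ) := by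
  have hclass (r : Fin d) :
      min (N : ℝ) k ≤ ∑ i ∈ copies n d m r, (sampleProb p (hardMatrix B m) k i : ℝ) := by
    have hN : (N : ℝ) ≤ (copies n d m r).card := by exact_mod_cast le_card_copies hm r
    calc min (N : ℝ) k
        ≤ (copies n d m r).card * min 1 (k * ((copies n d m r).card : ℝ)⁻¹) := by
          rcases (Nat.cast_nonneg (α := ℝ) (copies n d m r).card).eq_or_lt with h | h
          · rw [← h] at hN ⊢
            simpa using Or.inl hN
          · rw [mul_min_of_nonneg _ _ h.le, mul_one, mul_left_comm, mul_inv_cancel₀ h.ne', mul_one]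
            exact min_le_min_right _ hN
      _ = ∑ i ∈ copies n d m r, min 1 (k * ((copies n d m r).card : ℝ)⁻¹) := by simp
      _ ≤ _ := Finset.sum_le_sum fun i hi => min_le_min_left _
          (mul_le_mul_of_nonneg_left (le_leverageScore_hardMatrix B hp hi) k.2)
  calc d * min (N : ℝ) k = ∑ r : Fin d, min (N : ℝ) k := by simp
    _ ≤ ∑ r : Fin d, ∑ i ∈ copies n d m r, (sampleProb p (hardMatrix B m) k i : ℝ) :=
      Finset.sum_le_sum fun r _ => hclass r
    _ = ∑ i ∈ Finset.univ.biUnion (copies n d m), (sampleProb p (hardMatrix B m) k i : ℝ) := by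
      rw [Finset.sum_biUnion]
      intro r _ r' _ hne
      refine Finset.disjoint_left.2 fun i hi hi' => hne (Fin.ext ?_)
      exact (Finset.mem_filter.1 hi).2.2.symm.trans (Finset.mem_filter.1 hi').2.2
    _ ≤ _ := Finset.sum_le_univ_sum_of_nonneg fun i => (sampleProb p (hardMatrix B m) k i).2.1

/-- Fewer than `d` sampled rows of the block `B` cannot see all of the first `d` coordinates. -/
theorem not_sampleEmbeds_hardMatrix (hm : n ≤ m) {p : ℝ} (hp : p ≠ 0)
    (hB : ∀ x ≠ 0, 0 < lpPow p (B *ᵥ x)) {ω : Fin m → Bool}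
    (hω : ((Finset.univ.filter fun i : Fin m => i.1 < n).filter fun i => ω i = true).card < d) :
    ¬ SampleEmbeds p (hardMatrix B m) ω := by
  have hT : (Finset.univ.filter fun i : Fin n => ω (Fin.castLE hm i) = true).card < d := by
    refine lt_of_le_of_lt (Finset.card_le_card_of_injOn (Fin.castLE hm) ?_
      (Fin.castLE_injective hm).injOn) hω
    intro i hi
    simpa using hi
  obtain ⟨y, hy0, hy⟩ := exists_ne_zero_mulVec_eq_zero B _ hT
  let x : Fin (2 * d) → ℝ := fun j => if h : j.1 < d then y ⟨j, h⟩ else 0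
  have hxy : firstHalf x = y := by
    ext j
    simp [firstHalf, x]
  refine not_sampleEmbeds_of_mulVec_eq_zero hp (x := x) (fun i hi => ?_) ?_
  · by_cases h : i.1 < n
    · rw [hardMatrix_mulVec_of_lt B x h, hxy]
      exact hy _ (by simpa using hi)
    · have hd : 0 < d := lt_of_le_of_lt (Nat.zero_le _) hω
      have hlt : (i.1 - n) % d < d := Nat.mod_lt _ hd
      rw [hardMatrix_mulVec_of_le B x (not_lt.1 h) (j := ⟨d + (i - n) % d, by omega⟩) rfl]
      simp [x]
  · refine lt_of_lt_of_le ?_ (lpPow_le_lpPow_hardMatrix B hm p x)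
    rw [hxy]
    exact hB y hy0

theorem le_rowSampling_not_sampleEmbeds (hm : n ≤ m) {p L : ℝ} (hp : p ≠ 0) (hL : 0 ≤ L)
    (hpos : ∀ x ≠ 0, 0 < lpPow p (B *ᵥ x))
    (hB : ∀ x i, |(B *ᵥ x) i| ^ p ≤ L * lpPow p (B *ᵥ x)) (k : ℝ≥0) :
    1 - Real.exp (2 * (k * (n * L)) - d) ≤
      (rowSampling (sampleProb p (hardMatrix B m) k)).real
        {ω | ¬ SampleEmbeds p (hardMatrix B m) ω} := by
  set q := sampleProb p (hardMatrix B m) k with hq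
  have : IsProbabilityMeasure (rowSampling q) := by unfold rowSampling; infer_instance
  set R := Finset.univ.filter fun i : Fin m => i.1 < n with hR
  have hcard : R.card ≤ n := by
    rw [← Finset.card_range n]
    refine Finset.card_le_card_of_injOn Fin.val ?_ Fin.val_injective.injOn
    intro i hi
    simpa [hR] using hi
  have hsum : ∑ i ∈ R, (q i : ℝ) ≤ k * (n * L) := by
    have hkL : (0 : ℝ) ≤ k * L := mul_nonneg k.2 hL
    calc ∑ i ∈ R, (q i : ℝ) ≤ ∑ i ∈ R, k * L := Finset.sum_le_sum fun i hi =>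
          (min_le_right _ _).trans (mul_le_mul_of_nonneg_left
            (leverageScore_hardMatrix_le B hm hL hB (Finset.mem_filter.1 hi).2) k.2)
      _ = R.card * (k * L) := by simp
      _ ≤ n * (k * L) := mul_le_mul_of_nonneg_right (by exact_mod_cast hcard) hkL
      _ = _ := by ring
  set E := {ω : Fin m → Bool | d ≤ (R.filter fun i => ω i = true).card} with hE
  have hEc : Eᶜ ⊆ {ω | ¬ SampleEmbeds p (hardMatrix B m) ω} := fun ω hω =>
    not_sampleEmbeds_hardMatrix B hm hp hpos (not_le.1 hω)
  have h1 := rowSampling_real_le_card_le q R d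
  have h2 : Real.exp (2 * ∑ i ∈ R, (q i : ℝ) - d) ≤ Real.exp (2 * (k * (n * L)) - d) :=
    Real.exp_le_exp.2 (by linarith)
  have h3 := measureReal_mono (μ := rowSampling q) hEc
  rw [probReal_compl_eq_one_sub (Set.toFinite E).measurableSet] at h3
  linarith

end hardMatrix

end LpSampling

theorem mainTheorem2 :
    ∃ c : ℝ, 0 < c ∧ ∀ (p : ℝ) (d : ℕ), 1 ≤ p → 2 ≤ d →
      ∃ m₀ : ℕ, ∀ m : ℕ, m₀ ≤ m → ∃ A : Matrix (Fin m) (Fin (2 * d)) ℝ, ∀ k : ℝ≥0,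
        ((∑ i, (LpSampling.sampleProb p A k i : ℝ)
              < c * ((d : ℝ) ^ (2 - p / 2) / Real.log d ^ (p / 2))) →
          1 - Real.exp (-(c * d)) ≤
            (LpSampling.rowSampling (LpSampling.sampleProb p A k)).real
              {ω | ¬ LpSampling.SampleEmbeds p A ω}) ∧
        ((k : ℝ) < c * ((d : ℝ) ^ (1 - p / 2) / Real.log d ^ (p / 2)) →
          1 - Real.exp (-(c * d)) ≤
            (LpSampling.rowSampling (LpSampling.sampleProb p A k)).real
              {ω | ¬ LpSampling.SampleEmbeds p A ω}) := by
  refine ⟨1 / 32, by norm_num, fun p d hp hd => ?_⟩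
  obtain ⟨n, B, L, hL, hpos, hB, hnL⟩ := LpSampling.exists_matrix_small_leverage hp hd
  have hd0 : (0 : ℝ) < d := by
    have : 0 < d := by omega
    exact_mod_cast this
  have hlog : 0 < Real.log d := Real.log_pos (by exact_mod_cast hd)
  set K : ℝ := (d : ℝ) ^ (1 - p / 2) / Real.log d ^ (p / 2) with hK
  have hK0 : 0 < K := by positivity
  have hK2 : (d : ℝ) ^ (2 - p / 2) / Real.log d ^ (p / 2) = d * K := by
    rw [hK, show 2 - p / 2 = 1 + (1 - p / 2) by ring, Real.rpow_add hd0, Real.rpow_one, mul_div_assoc]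
  have hKd : K * (d * Real.log d) ^ (p / 2) = d := by
    rw [hK, Real.mul_rpow hd0.le hlog.le, div_mul_eq_mul_div, ← mul_assoc, ← Real.rpow_add hd0,
      mul_div_cancel_right₀ _ (by positivity), sub_add_cancel, Real.rpow_one]
  -- At least `min N k` copies of each basis vector are sampled in expectation; since `K / 32 ≤ N`,
  -- an expected total below `d * K / 32` forces `k < K / 32`.
  obtain ⟨N, hN⟩ := exists_nat_ge (1 / 32 * K)
  refine ⟨n + d * N, fun m hm => ⟨LpSampling.hardMatrix B m, fun k => ?_⟩⟩
  have hfail (hk : (k : ℝ) < 1 / 32 * K) : 1 - Real.exp (-(1 / 32 * d)) ≤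
      (LpSampling.rowSampling (LpSampling.sampleProb p (LpSampling.hardMatrix B m) k)).real
        {ω | ¬ LpSampling.SampleEmbeds p (LpSampling.hardMatrix B m) ω} := by
    refine le_trans ?_ (LpSampling.le_rowSampling_not_sampleEmbeds B (by omega) (by linarith) hL
      hpos hB k)
    have h1 : k * (n * L) ≤ 1 / 4 * d := calc
      k * (n * L) ≤ 1 / 32 * K * (8 * (d * Real.log d) ^ (p / 2)) := by gcongr
      _ = 1 / 4 * d := by linear_combination 1 / 4 * hKd
    have h2 : Real.exp (2 * (k * (n * L)) - d) ≤ Real.exp (-(1 / 32 * d)) :=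
      Real.exp_le_exp.2 (by linarith)
    linarith
  refine ⟨fun h => hfail ?_, hfail⟩
  have h1 := (LpSampling.mul_min_le_sum_sampleProb B (by linarith : p ≠ 0) hm k).trans_lt h
  rw [hK2, mul_left_comm, mul_lt_mul_iff_right₀ hd0] at h1
  exact (min_lt_iff.1 h1).resolve_left hN.not_gt
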